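/- Let $(a)_k=a(a+1)\cdots(a+k-1)$ denote the rising factorial (with $(a)_0=1$), and let the Euler numbers $E_n$ be defined by $$\frac{2}{e^x+e^{-x}}=\sum_{n=0}^\infty E_n\frac{x^n}{n!}.$$ For a positive integer $m$ and an odd prime $p$ put $$S_m=S_m(p)=\sum_{k=0}^{\frac{p-1}{2}}(-1)^k(4k+1)^m\left(\frac{(1/2)_k}{(1)_k}\right)^3,\qquad (1)_k=k!.$$ Then for every positive odd integer $m$ there exist integers $a_m$ and $c_m$, depending only on $m$, such that for every prime $p\ge 5$ $$S_m\equiv a_m\left(p(-1)^{\frac{p-1}{2}}+p^3E_{p-3}\right)+p^3c_m\pmod{p^4}.$$ Here the congruence is between rational numbers: $x\equiv y\pmod{p^4}$ means that $(x-y)/p^4$ is a rational number whose reduced denominator is not divisible by $p$. -/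

import Mathlib

/-- The Euler numbers `E_n`, defined by the exponential generating function
`2 / (e^x + e^{-x}) = ∑ E_n x^n / n!`. The power series `e^x + e^{-x}` has constant term `2`,
so the inverse is the genuine multiplicative inverse in `ℚ⟦x⟧`. -/
noncomputable def eulerNumber (n : ℕ) : ℚ :=
  (n.factorial : ℚ) * PowerSeries.coeff n
    (2 * (PowerSeries.exp ℚ + PowerSeries.evalNegHom (PowerSeries.exp ℚ))⁻¹)

/-- Congruence of rational numbers modulo `N`: `x ≡ y (mod N)` means that `x - y` is `N` times
a rational number whose (reduced) denominator is coprime to `N`. -/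
def RatModEq (N : ℕ) (x y : ℚ) : Prop :=
  ∃ r : ℚ, r.den.Coprime N ∧ x - y = (N : ℚ) * r

/-- The sum `S_m = ∑_{k=0}^{(p-1)/2} (-1)^k (4k+1)^m ((1/2)_k / (1)_k)^3`, where
`(a)_k = a (a+1) ⋯ (a+k-1)` is the rising factorial. -/
noncomputable def alternatingCubeSum (m p : ℕ) : ℚ :=
  ∑ k ∈ Finset.range ((p - 1) / 2 + 1),
    (-1 : ℚ) ^ k * (4 * (k : ℚ) + 1) ^ m *
      ((ascPochhammer ℚ k).eval (1 / 2 : ℚ) / (ascPochhammer ℚ k).eval (1 : ℚ)) ^ 3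

/-!
Write `p = 2N + 1`, `h_k = (1/2)_k`, and work in the ring of rationals with denominator prime to `p`.

For weight `4k + 1` the functions `wzF` and `wzG` satisfy
`wzF n k - wzF n (k + 1) = wzG (n + 1) k - wzG n k`, and `wzF n 0` is the summand. As `wzF n N`
vanishes for `n < N`, the sum equals `wzF N N + ∑ k < N, wzG (N + 1) k`.

* The boundary term is exactly `p (-1) ^ N ∏ j ≤ N, (1 - p ^ 2 / (4 j ^ 2))` (`wzF_self_eq`), hence
  `p (-1) ^ N` modulo `p ^ 4` because `∑ j ≤ N, 1 / j ^ 2` is divisible by `p`.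
* Each `wzG (N + 1) k` contains three factors `p / 2`, so the remaining factors matter only modulo
  `p`, where `h_k` becomes `(-N)_k`. The resulting sum of reciprocal binomial type has a closed form
  (`sum_neg_one_pow_mul_factorial_div`) in terms of `∑ 1 / j ^ 2` and `∑ (-1) ^ j / j ^ 2`, and the
  latter is a multiple of `E_{p-3}` modulo `p` (`eulerNumber_sub_three_modEq`). This last congruence
  comes from summing `(-1) ^ j (2j + 1) ^ (p - 3)` over `j < p` by means of the Appell polynomials of
  the Euler numbers.

For a general odd weight put `x = 4k + 1`. The odd part of `(x + 1) ^ 3 (x + 2) ^ (2j)` is a monic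
integral polynomial of degree `2j + 3`, and the sum with this weight telescopes to `4 p ^ 3` modulo
`p ^ 4` (`exists_monic_oddWeightSum_modEq`). Together with the weight `x` these span all odd integral
polynomials over `ℤ`, so every odd power of `x` reduces to an integral multiple of the linear weight
plus an integral multiple of `p ^ 3`.
-/

/-! ### Rational numbers with denominator prime to `N` -/

/-- The ring of rational numbers whose reduced denominator is coprime to `N`. -/
def coprimeDen (N : ℕ) : Subring ℚ where
  carrier := {r | r.den.Coprime N}
  mul_mem' {a b} ha hb :=
    Nat.Coprime.coprime_dvd_left (Rat.mul_den_dvd a b) (Nat.Coprime.mul_left ha hb)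
  one_mem' := by simp
  add_mem' {a b} ha hb :=
    Nat.Coprime.coprime_dvd_left (Rat.add_den_dvd a b) (Nat.Coprime.mul_left ha hb)
  zero_mem' := by simp
  neg_mem' {a} ha := by simpa using ha

theorem mem_coprimeDen {N : ℕ} {r : ℚ} : r ∈ coprimeDen N ↔ r.den.Coprime N := Iff.rfl

theorem inv_natCast_mem_coprimeDen {N a : ℕ} (h : a.Coprime N) :
    ((a : ℚ)⁻¹) ∈ coprimeDen N := by
  rw [mem_coprimeDen, Rat.inv_natCast_den]
  split_ifs with h0
  · simp
  · exact h

/-- Below a prime `p`, every positive natural number is invertible modulo `p`. -/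
theorem inv_natCast_mem_coprimeDen_of_lt {p a : ℕ} (hp : p.Prime) (h0 : 0 < a) (h : a < p) :
    ((a : ℚ)⁻¹) ∈ coprimeDen p :=
  inv_natCast_mem_coprimeDen (Nat.coprime_of_lt_prime h0.ne' h hp).symm

theorem inv_factorial_mem_coprimeDen {p a : ℕ} (hp : p.Prime) (h : a < p) :
    ((a.factorial : ℚ)⁻¹) ∈ coprimeDen p :=
  inv_natCast_mem_coprimeDen (hp.coprime_factorial_of_lt h).symm

theorem neg_one_pow_mem_coprimeDen (N k : ℕ) : (-1 : ℚ) ^ k ∈ coprimeDen N :=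
  pow_mem (neg_mem (one_mem _)) _

theorem inv_two_mem_coprimeDen {p : ℕ} (hp : p.Prime) (h : 2 < p) :
    (1 / 2 : ℚ) ∈ coprimeDen p := by
  simpa using inv_natCast_mem_coprimeDen_of_lt hp two_pos h

namespace RatModEq

variable {N : ℕ} {x y z w : ℚ}

theorem refl (N : ℕ) (x : ℚ) : RatModEq N x x := ⟨0, by simp, by simp⟩

theorem of_eq (h : x = y) : RatModEq N x y := h ▸ refl N x

theorem symm (h : RatModEq N x y) : RatModEq N y x := by
  obtain ⟨r, hr, e⟩ := h
  exact ⟨-r, by simpa using hr, by linear_combination -e⟩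

theorem trans (h : RatModEq N x y) (h' : RatModEq N y z) : RatModEq N x z := by
  obtain ⟨r, hr, e⟩ := h
  obtain ⟨s, hs, e'⟩ := h'
  exact ⟨r + s, (coprimeDen N).add_mem hr hs, by linear_combination e + e'⟩

theorem add (h : RatModEq N x y) (h' : RatModEq N z w) : RatModEq N (x + z) (y + w) := by
  obtain ⟨r, hr, e⟩ := h
  obtain ⟨s, hs, e'⟩ := h'
  exact ⟨r + s, (coprimeDen N).add_mem hr hs, by linear_combination e + e'⟩

theorem mul_left {c : ℚ} (hc : c ∈ coprimeDen N) (h : RatModEq N x y) :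
    RatModEq N (c * x) (c * y) := by
  obtain ⟨r, hr, e⟩ := h
  exact ⟨c * r, (coprimeDen N).mul_mem hc hr, by linear_combination c * e⟩

theorem mem (h : RatModEq N x y) (hy : y ∈ coprimeDen N) : x ∈ coprimeDen N := by
  obtain ⟨r, hr, e⟩ := h
  rw [show x = y + N * r by linear_combination e]
  exact add_mem hy (mul_mem (natCast_mem _ _) hr)

theorem mul (h : RatModEq N x y) (h' : RatModEq N z w) (hy : y ∈ coprimeDen N)
    (hw : w ∈ coprimeDen N) : RatModEq N (x * z) (y * w) := by
  have h1 := mul_left (h.mem hy) h'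
  have h2 := mul_left hw h
  exact h1.trans (by simpa [mul_comm] using h2)

theorem pow (h : RatModEq N x y) (hy : y ∈ coprimeDen N) (k : ℕ) :
    RatModEq N (x ^ k) (y ^ k) := by
  induction k with
  | zero => simpa using refl N 1
  | succ k ih =>
    rw [pow_succ, pow_succ]
    exact ih.mul h (pow_mem hy _) hy

theorem inv (h : RatModEq N x y) (hx : x⁻¹ ∈ coprimeDen N) (hy : y⁻¹ ∈ coprimeDen N)
    (hx0 : x ≠ 0) (hy0 : y ≠ 0) : RatModEq N x⁻¹ y⁻¹ := by
  have h1 := (mul_left (mul_mem hx hy) h).symm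
  convert h1 using 1 <;> field_simp

theorem sum {ι : Type*} (s : Finset ι) {f g : ι → ℚ} (h : ∀ i ∈ s, RatModEq N (f i) (g i)) :
    RatModEq N (∑ i ∈ s, f i) (∑ i ∈ s, g i) := by
  classical
  induction s using Finset.induction_on with
  | empty => simpa using refl N 0
  | insert a s ha ih =>
    rw [Finset.sum_insert ha, Finset.sum_insert ha]
    exact (h a (Finset.mem_insert_self a s)).add
      (ih fun i hi => h i (Finset.mem_insert_of_mem hi))

theorem of_intModEq {a b : ℤ} (h : a ≡ b [ZMOD N]) : RatModEq N (a : ℚ) (b : ℚ) := by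
  obtain ⟨c, hc⟩ := h.symm.dvd
  exact ⟨c, by simp, by exact_mod_cast hc⟩

/-- A congruence modulo `p` becomes one modulo `p ^ (k + 1)` after multiplication by `p ^ k`. -/
theorem pow_mul {p : ℕ} (k : ℕ) (h : RatModEq p x y) :
    RatModEq (p ^ (k + 1)) ((p : ℚ) ^ k * x) ((p : ℚ) ^ k * y) := by
  obtain ⟨r, hr, e⟩ := h
  exact ⟨r, Nat.Coprime.pow_right _ hr, by push_cast; linear_combination (p : ℚ) ^ k * e⟩

end RatModEq

/-- Fermat's little theorem in the form `a ^ (p - 3) ≡ a⁻²`. -/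
theorem pow_sub_three_modEq {p a : ℕ} (hp : p.Prime) (h5 : 5 ≤ p) (h0 : 0 < a) (h : a < p) :
    RatModEq p ((a : ℚ) ^ (p - 3)) (1 / (a : ℚ) ^ 2) := by
  have ha := inv_natCast_mem_coprimeDen_of_lt hp h0 h
  have hz : (a : ℤ) ^ (p - 1) ≡ 1 [ZMOD p] := by
    apply Int.ModEq.pow_card_sub_one_eq_one hp
    exact Nat.isCoprime_iff_coprime.mpr (Nat.coprime_of_lt_prime h0.ne' h hp).symm
  have h1 := RatModEq.mul_left (mul_mem ha ha) (RatModEq.of_intModEq hz)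
  have ha0 : (a : ℚ) ≠ 0 := by positivity
  convert h1 using 1
  · push_cast
    rw [show p - 1 = (p - 3) + 2 by omega, pow_add]
    field_simp
  · push_cast
    field_simp

/-! ### Reciprocal squares up to half of a prime -/

theorem sum_one_div_sq_modEq_zero {p N : ℕ} (hp : p.Prime) (h5 : 5 ≤ p) (hN : p = 2 * N + 1) :
    RatModEq p (∑ j ∈ Finset.range N, 1 / ((j : ℚ) + 1) ^ 2) 0 := by
  have : Fact p.Prime := ⟨hp⟩
  have hev : Even (p - 3) := ⟨N - 1, by omega⟩
  -- The power sum over the whole field vanishes, and `x ↦ -x` pairs its two halves.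
  have hZ : ∑ j ∈ Finset.range N, ((j : ZMod p) + 1) ^ (p - 3) = 0 := by
    have h0 : ∑ x : ZMod p, x ^ (p - 3) = 0 :=
      FiniteField.sum_pow_lt_card_sub_one _ _ (by rw [ZMod.card]; omega)
    have h1 : ∑ x : ZMod p, x ^ (p - 3) = ∑ j ∈ Finset.range p, (j : ZMod p) ^ (p - 3) := by
      symm
      refine Finset.sum_nbij' (fun j => (j : ZMod p)) (fun x => x.val) ?_ ?_ ?_ ?_ ?_
      · simp
      · intro x _; simpa using ZMod.val_lt x
      · intro j hj; exact ZMod.val_cast_of_lt (Finset.mem_range.mp hj)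
      · intro x _; simp
      · simp
    have h2 : ∑ j ∈ Finset.range N, (((N + 1 + j : ℕ) : ZMod p)) ^ (p - 3)
        = ∑ j ∈ Finset.range N, ((j : ZMod p) + 1) ^ (p - 3) := by
      rw [← Finset.sum_range_reflect]
      refine Finset.sum_congr rfl fun j hj => ?_
      have hj := Finset.mem_range.mp hj
      rw [← hev.neg_pow]
      congr 1
      have : ((N + 1 + (N - 1 - j) + (j + 1) : ℕ) : ZMod p) = 0 := by
        rw [show N + 1 + (N - 1 - j) + (j + 1) = p by omega]; simp
      push_cast at this ⊢
      linear_combination -this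
    have h3 := Finset.sum_range_add (fun j => (j : ZMod p) ^ (p - 3)) (N + 1) N
    rw [show N + 1 + N = p by omega] at h3
    rw [h1, h3, h2, Finset.sum_range_succ'] at h0
    push_cast at h0
    rw [zero_pow (by omega), add_zero, ← two_mul] at h0
    refine (mul_eq_zero.mp h0).resolve_left ?_
    intro h
    have : ((2 : ℕ) : ZMod p) = 0 := by exact_mod_cast h
    rw [ZMod.natCast_eq_zero_iff] at this
    exact absurd (Nat.le_of_dvd two_pos this) (by omega)
  have hI : (∑ j ∈ Finset.range N, ((j : ℤ) + 1) ^ (p - 3)) ≡ 0 [ZMOD p] := by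
    rw [← ZMod.intCast_eq_intCast_iff]
    push_cast
    exact hZ
  have h := RatModEq.of_intModEq hI
  push_cast at h
  refine (RatModEq.sum _ fun j hj => ?_).trans h
  have hj := Finset.mem_range.mp hj
  have := pow_sub_three_modEq (a := j + 1) hp h5 (by omega) (by omega)
  push_cast at this
  exact this.symm

/-! ### Euler numbers modulo a prime -/

/-- The exponential generating function of the Euler numbers. -/
noncomputable def eulerSeries : PowerSeries ℚ :=
  2 * (PowerSeries.exp ℚ + PowerSeries.evalNegHom (PowerSeries.exp ℚ))⁻¹

theorem eulerSeries_mul :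
    eulerSeries * (PowerSeries.exp ℚ + PowerSeries.evalNegHom (PowerSeries.exp ℚ)) = 2 := by
  rw [eulerSeries, mul_assoc, PowerSeries.inv_mul_cancel, mul_one]
  simp [PowerSeries.evalNegHom, PowerSeries.rescale, ← PowerSeries.coeff_zero_eq_constantCoeff]

/-- The Appell polynomial `∑ i, n.choose i * E_i * t ^ (n - i)` of the Euler numbers, encoded as
the `n`-th coefficient of `2 e^{tx} / (e^x + e^{-x})` in the exponential sense. -/
noncomputable def eulerAppell (n : ℕ) (t : ℚ) : ℚ :=
  (n.factorial : ℚ) * PowerSeries.coeff n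
    (eulerSeries * PowerSeries.rescale t (PowerSeries.exp ℚ))

theorem eulerAppell_eq_sum (n : ℕ) (t : ℚ) :
    eulerAppell n t = ∑ i ∈ Finset.range (n + 1), (n.choose i : ℚ) * eulerNumber i * t ^ (n - i) := by
  rw [eulerAppell, PowerSeries.coeff_mul, Finset.Nat.sum_antidiagonal_eq_sum_range_succ_mk,
    Finset.mul_sum]
  refine Finset.sum_congr rfl fun i hi => ?_
  have hi : i ≤ n := Nat.lt_succ_iff.mp (Finset.mem_range.mp hi)
  rw [eulerNumber, ← eulerSeries, Nat.cast_choose ℚ hi]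
  simp only [PowerSeries.coeff_rescale, PowerSeries.coeff_exp]
  have : (i.factorial : ℚ) ≠ 0 := by positivity
  have : ((n - i).factorial : ℚ) ≠ 0 := by positivity
  simp
  field_simp

theorem eulerAppell_zero (n : ℕ) : eulerAppell n 0 = eulerNumber n := by
  rw [eulerAppell_eq_sum, Finset.sum_range_succ, Finset.sum_eq_zero]
  · simp
  · intro i hi
    have := Finset.mem_range.mp hi
    rw [zero_pow (by omega), mul_zero]

/-- The defining relation `E(x) (e ^ x + e ^ (-x)) = 2` multiplied by `e ^ (t x)`. -/
theorem eulerAppell_add_one_add_sub_one (n : ℕ) (t : ℚ) :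
    eulerAppell n (t + 1) + eulerAppell n (t - 1) = 2 * t ^ n := by
  have hneg : PowerSeries.evalNegHom (PowerSeries.exp ℚ)
      = PowerSeries.rescale (-1 : ℚ) (PowerSeries.exp ℚ) := rfl
  have h1 : PowerSeries.rescale (1 : ℚ) (PowerSeries.exp ℚ) = PowerSeries.exp ℚ := by
    simp
  have key : eulerSeries * PowerSeries.rescale (t + 1) (PowerSeries.exp ℚ)
      + eulerSeries * PowerSeries.rescale (t - 1) (PowerSeries.exp ℚ)
      = 2 * PowerSeries.rescale t (PowerSeries.exp ℚ) := by
    rw [sub_eq_add_neg, ← PowerSeries.exp_mul_exp_eq_exp_add, ← PowerSeries.exp_mul_exp_eq_exp_add,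
      ← hneg, h1, ← eulerSeries_mul]
    ring
  rw [eulerAppell, eulerAppell, ← mul_add, ← map_add, key, two_mul, map_add,
    PowerSeries.coeff_rescale, PowerSeries.coeff_exp]
  have : (n.factorial : ℚ) ≠ 0 := by positivity
  simp
  field_simp
  ring

theorem exists_intCast_eq_eulerNumber (n : ℕ) : ∃ z : ℤ, eulerNumber n = z := by
  induction n using Nat.strong_induction_on with
  | _ n ih =>
    choose! z hz using ih
    have h := eulerAppell_add_one_add_sub_one n 0
    rw [eulerAppell_eq_sum, eulerAppell_eq_sum, Finset.sum_range_succ, Finset.sum_range_succ] at h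
    simp only [zero_add, one_pow, mul_one, Nat.choose_self, Nat.cast_one, one_mul, Nat.sub_self,
      pow_zero, zero_sub] at h
    -- Solving for `2 * eulerNumber n` leaves a sum of terms with coefficients `1 + (-1) ^ (n - i)`.
    have h2 : eulerNumber n = (0 : ℚ) ^ n - ∑ i ∈ Finset.range n,
        (n.choose i : ℚ) * eulerNumber i * ((1 + (-1) ^ (n - i)) / 2) := by
      have : ∑ i ∈ Finset.range n, (n.choose i : ℚ) * eulerNumber i * ((1 + (-1) ^ (n - i)) / 2)
          = ((∑ i ∈ Finset.range n, (n.choose i : ℚ) * eulerNumber i)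
            + ∑ i ∈ Finset.range n, (n.choose i : ℚ) * eulerNumber i * (-1) ^ (n - i)) / 2 := by
        rw [← Finset.sum_add_distrib, Finset.sum_div]
        exact Finset.sum_congr rfl fun i _ => by ring
      rw [this]
      linear_combination h / 2
    refine ⟨(0 : ℤ) ^ n - ∑ i ∈ Finset.range n, (n.choose i : ℤ) * z i *
      (if Even (n - i) then 1 else 0), ?_⟩
    rw [h2]
    push_cast
    congr 1
    refine Finset.sum_congr rfl fun i hi => ?_
    rw [hz i (Finset.mem_range.mp hi)]
    congr 1
    split_ifs with he
    · rw [he.neg_one_pow]; norm_num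
    · rw [(Nat.not_even_iff_odd.mp he).neg_one_pow]; norm_num

theorem eulerNumber_mem_coprimeDen (N n : ℕ) : eulerNumber n ∈ coprimeDen N := by
  obtain ⟨z, hz⟩ := exists_intCast_eq_eulerNumber n
  rw [hz]
  exact intCast_mem _ _

theorem two_mul_sum_neg_one_pow_mul_odd_pow (n M : ℕ) :
    2 * ∑ j ∈ Finset.range M, (-1 : ℚ) ^ j * (2 * j + 1) ^ n
      = eulerAppell n 0 - (-1) ^ M * eulerAppell n (2 * M) := by
  induction M with
  | zero => simp
  | succ M ih =>
    have h := eulerAppell_add_one_add_sub_one n (2 * M + 1)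
    rw [Finset.sum_range_succ, mul_add, ih]
    rw [show (2 * (M : ℚ) + 1 + 1) = 2 * ((M + 1 : ℕ) : ℚ) by push_cast; ring,
      show (2 * (M : ℚ) + 1 - 1) = 2 * M by ring] at h
    rw [pow_succ]
    linear_combination -(-1 : ℚ) ^ M * h

/-- The Appell polynomial takes congruent values at `0` and `2 p`, and its value at `0` is `E_n`. -/
theorem sum_neg_one_pow_mul_odd_pow_modEq {p : ℕ} (hp : p.Prime) (h2 : 2 < p) (n : ℕ) :
    RatModEq p (∑ j ∈ Finset.range p, (-1 : ℚ) ^ j * (2 * j + 1) ^ n) (eulerNumber n) := by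
  have h := two_mul_sum_neg_one_pow_mul_odd_pow n p
  rw [(hp.odd_of_ne_two (by omega)).neg_one_pow, eulerAppell_zero] at h
  have h1 : RatModEq p (eulerAppell n (2 * p)) (eulerNumber n) := by
    rw [← eulerAppell_zero n, eulerAppell_eq_sum, eulerAppell_eq_sum]
    refine RatModEq.sum _ fun i _ => RatModEq.mul_left
      (mul_mem (natCast_mem _ _) (eulerNumber_mem_coprimeDen _ _)) (RatModEq.pow ?_ (zero_mem _) _)
    exact ⟨2, by simp, by ring⟩
  have h3 := RatModEq.mul_left (inv_two_mem_coprimeDen hp h2)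
    ((RatModEq.refl p (eulerNumber n)).add h1)
  convert h3 using 1
  · linear_combination h / 2
  · ring

/-- `E_{p-3}` modulo `p` as an alternating sum of reciprocal squares: the odd numbers below `2p`
are `p ± 2i` with `i ≤ (p - 1) / 2`. -/
theorem eulerNumber_sub_three_modEq {p N : ℕ} (hp : p.Prime) (h5 : 5 ≤ p) (hN : p = 2 * N + 1) :
    RatModEq p ((1 / 2) * (-1) ^ N * ∑ j ∈ Finset.range N, (-1 : ℚ) ^ (j + 1) / ((j : ℚ) + 1) ^ 2)
      (eulerNumber (p - 3)) := by
  refine RatModEq.trans ?_ (sum_neg_one_pow_mul_odd_pow_modEq hp (by omega) _)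
  have hev : Even (p - 3) := ⟨N - 1, by omega⟩
  have hpQ : (p : ℚ) = 2 * N + 1 := by rw [hN]; push_cast; ring
  -- Modulo `p`, an odd number `p ± 2 (j + 1)` has `(p - 3)`-th power `1 / (4 (j + 1) ^ 2)`.
  have term : ∀ (c : ℚ), c ∈ coprimeDen p → ∀ a : ℚ, ∀ j ∈ Finset.range N, RatModEq p a 0 →
      ∀ b : ℚ, b = 2 * ((j : ℚ) + 1) ∨ b = -(2 * ((j : ℚ) + 1)) →
      RatModEq p (c * (1 / 4 * (1 / ((j : ℚ) + 1) ^ 2))) (c * (a + b) ^ (p - 3)) := by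
    intro c hc a j hj ha b hb
    have hj := Finset.mem_range.mp hj
    have h1 := pow_sub_three_modEq (a := 2 * (j + 1)) hp h5 (by omega) (by omega)
    have hbm : b ∈ coprimeDen p := by
      have h2 : (2 * ((j : ℚ) + 1)) ∈ coprimeDen p := by
        simpa using natCast_mem (coprimeDen p) (2 * (j + 1))
      rcases hb with rfl | rfl
      · exact h2
      · exact neg_mem h2
    have h2 := (ha.add (RatModEq.refl p b)).pow (by simpa using hbm) (p - 3)
    have h3 : (0 + b) ^ (p - 3) = ((2 * (j + 1) : ℕ) : ℚ) ^ (p - 3) := by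
      rw [zero_add]; push_cast
      rcases hb with rfl | rfl
      · rfl
      · rw [hev.neg_pow]
    rw [h3] at h2
    refine RatModEq.mul_left hc ?_
    refine RatModEq.trans (RatModEq.of_eq ?_) (h2.trans h1).symm
    push_cast
    field_simp
    norm_num
  have hpp : RatModEq p (p : ℚ) 0 := ⟨1, by simp, by ring⟩
  have e : (1 / 2 : ℚ) * (-1) ^ N * ∑ j ∈ Finset.range N, (-1 : ℚ) ^ (j + 1) / ((j : ℚ) + 1) ^ 2
      = (∑ j ∈ Finset.range N, (-1 : ℚ) ^ (N + (j + 1)) * (1 / 4 * (1 / ((j : ℚ) + 1) ^ 2)))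
        + ((∑ j ∈ Finset.range N, (-1 : ℚ) ^ (N + (j + 1)) * (1 / 4 * (1 / ((j : ℚ) + 1) ^ 2)))
        + 0) := by
    rw [add_zero, ← two_mul, Finset.mul_sum, Finset.mul_sum]
    refine Finset.sum_congr rfl fun j _ => ?_
    rw [pow_add (-1 : ℚ) N]
    ring
  -- The middle term, that of the odd number `p` itself, vanishes modulo `p`.
  have hsplit := Finset.sum_range_add (fun j : ℕ => (-1 : ℚ) ^ j * (2 * j + 1) ^ (p - 3)) N (N + 1)
  rw [show N + (N + 1) = p by omega] at hsplit
  rw [e, hsplit, Finset.sum_range_succ',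
    ← Finset.sum_range_reflect (fun j : ℕ => (-1 : ℚ) ^ j * (2 * j + 1) ^ (p - 3)) N]
  refine (RatModEq.sum _ fun j hj => ?_).add ((RatModEq.sum _ fun j hj => ?_).add ?_)
  · have h := term _ (neg_one_pow_mem_coprimeDen p (N + (j + 1))) _ j hj hpp _ (Or.inr rfl)
    have hj := Finset.mem_range.mp hj
    refine h.trans (RatModEq.of_eq ?_)
    congr 1
    · rw [show N + (j + 1) = (N - 1 - j) + 2 * (j + 1) by omega, pow_add, pow_mul]; simp
    · congr 1
      rw [Nat.cast_sub (by omega), Nat.cast_sub (by omega), hpQ]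
      push_cast
      ring
  · have h := term _ (neg_one_pow_mem_coprimeDen p (N + (j + 1))) _ j hj hpp _ (Or.inl rfl)
    refine h.trans (RatModEq.of_eq ?_)
    congr 2
    push_cast
    rw [hpQ]
    ring
  · have h := RatModEq.mul_left (neg_one_pow_mem_coprimeDen p N) (hpp.pow (zero_mem _) (p - 3))
    rw [zero_pow (by omega), mul_zero] at h
    refine h.symm.trans (RatModEq.of_eq ?_)
    rw [hpQ]
    simp

/-! ### A telescoping pair for the linear weight -/

/-- The rising factorial `(1/2)_k`. -/
noncomputable def halfPochhammer (k : ℕ) : ℚ := (ascPochhammer ℚ k).eval (1 / 2 : ℚ)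

theorem halfPochhammer_zero : halfPochhammer 0 = 1 := by simp [halfPochhammer]

theorem halfPochhammer_succ (k : ℕ) :
    halfPochhammer (k + 1) = halfPochhammer k * (1 / 2 + k) := by
  simp [halfPochhammer, ascPochhammer_succ_eval]

theorem halfPochhammer_pos (k : ℕ) : 0 < halfPochhammer k := ascPochhammer_pos k _ (by norm_num)

theorem cast_descFactorial_succ (n k : ℕ) :
    (n.descFactorial (k + 1) : ℚ) = (n - k) * n.descFactorial k := by
  rw [Nat.descFactorial_succ]
  rcases le_or_gt k n with h | h
  · push_cast [Nat.cast_sub h]; ring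
  · simp [Nat.descFactorial_of_lt h]

/-- The first member of the telescoping pair, which extends the summand
`(-1) ^ n * (4 * n + 1) * ((1/2)_n / n!) ^ 3` at `k = 0`. The factor
`n.descFactorial k / n!` stands for `1 / (n - k)!`, and so vanishes for `n < k`. -/
noncomputable def wzF (n k : ℕ) : ℚ :=
  (-1) ^ (n + k) * (4 * n + 1) * halfPochhammer n ^ 2 * halfPochhammer (n + k) *
    n.descFactorial k / ((n.factorial : ℚ) ^ 3 * halfPochhammer k ^ 2)

/-- The second member of the telescoping pair, with its second argument shifted by one. -/
noncomputable def wzG (n k : ℕ) : ℚ :=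
  2 * (-1) ^ (n + k + 1) * halfPochhammer n ^ 2 * halfPochhammer (n + k) * (n : ℚ) ^ 2 *
    n.descFactorial (k + 1) / ((n.factorial : ℚ) ^ 3 * halfPochhammer (k + 1) ^ 2)

theorem wzF_sub_wzF_succ (n k : ℕ) : wzF n k - wzF n (k + 1) = wzG (n + 1) k - wzG n k := by
  have h1 := (halfPochhammer_pos k).ne'
  have h2 : (n.factorial : ℚ) ≠ 0 := by positivity
  have h3 : (1 / 2 + k : ℚ) ≠ 0 := by positivity
  have h4 : (n + 1 : ℚ) ≠ 0 := by positivity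
  rw [wzF, wzF, wzG, wzG, Nat.succ_descFactorial_succ, ← add_assoc, add_right_comm n 1 k,
    halfPochhammer_succ, halfPochhammer_succ k, halfPochhammer_succ n, cast_descFactorial_succ,
    Nat.factorial_succ, pow_succ, pow_succ, pow_succ]
  push_cast
  field_simp
  ring

/-- Summing the telescoping relation over `n ≤ N` leaves only `wzG (N + 1) k`, as `wzG 0 k = 0`. -/
theorem sum_wzF_zero (N K : ℕ) :
    ∑ n ∈ Finset.range (N + 1), wzF n 0
      = ∑ n ∈ Finset.range (N + 1), wzF n K + ∑ k ∈ Finset.range K, wzG (N + 1) k := by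
  induction K with
  | zero => simp
  | succ K ih =>
    have h : ∑ n ∈ Finset.range (N + 1), (wzF n K - wzF n (K + 1)) = wzG (N + 1) K := by
      simp_rw [wzF_sub_wzF_succ]
      rw [Finset.sum_range_sub fun n => wzG n K]
      simp [wzG]
    rw [Finset.sum_sub_distrib] at h
    rw [ih, Finset.sum_range_succ _ K]
    linear_combination h

theorem alternatingCubeSum_one_eq (p N : ℕ) (hN : p = 2 * N + 1) :
    alternatingCubeSum 1 p = wzF N N + ∑ k ∈ Finset.range N, wzG (N + 1) k := by
  have h : alternatingCubeSum 1 p = ∑ n ∈ Finset.range (N + 1), wzF n 0 := by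
    rw [alternatingCubeSum, show (p - 1) / 2 = N by omega]
    refine Finset.sum_congr rfl fun k _ => ?_
    rw [ascPochhammer_eval_one, ← halfPochhammer, wzF, halfPochhammer_zero]
    have : (k.factorial : ℚ) ≠ 0 := by positivity
    simp
    field_simp
  rw [h, sum_wzF_zero N N, Finset.sum_range_succ, Finset.sum_eq_zero, zero_add]
  intro n hn
  simp [wzF, Nat.descFactorial_of_lt (Finset.mem_range.mp hn)]

/-! ### Half-integral rising factorials modulo a prime -/

/-- Since `1 / 2 = p / 2 - N`, the rising factorial of `1 / 2` agrees with that of `-N` modulo `p`. -/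
theorem halfPochhammer_modEq {p N : ℕ} (hp : p.Prime) (h2 : 2 < p) (hN : p = 2 * N + 1) (k : ℕ) :
    RatModEq p (halfPochhammer k) ((-1) ^ k * N.descFactorial k) := by
  induction k with
  | zero => simpa [halfPochhammer_zero] using RatModEq.refl p 1
  | succ k ih =>
    have h : RatModEq p (1 / 2 + k) ((k : ℚ) - N) :=
      ⟨1 / 2, inv_two_mem_coprimeDen hp h2, by rw [hN]; push_cast; ring⟩
    rw [halfPochhammer_succ, cast_descFactorial_succ]
    refine (ih.mul h (mul_mem (neg_one_pow_mem_coprimeDen _ _) (natCast_mem _ _))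
      (sub_mem (natCast_mem _ _) (natCast_mem _ _))).trans (RatModEq.of_eq ?_)
    ring

theorem inv_halfPochhammer_mem {p N k : ℕ} (hp : p.Prime) (hN : p = 2 * N + 1) (hk : k ≤ N) :
    (halfPochhammer k)⁻¹ ∈ coprimeDen p := by
  induction k with
  | zero => simp [halfPochhammer_zero]
  | succ k ih =>
    rw [halfPochhammer_succ, mul_inv]
    refine mul_mem (ih (by omega)) ?_
    have h := inv_natCast_mem_coprimeDen_of_lt (a := 2 * k + 1) hp (by omega) (by omega)
    have h2 : (1 / 2 + k : ℚ)⁻¹ = (2 : ℕ) * ((2 * k + 1 : ℕ) : ℚ)⁻¹ := by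
      push_cast
      field_simp
      ring
    rw [h2]
    exact mul_mem (natCast_mem _ _) h

theorem halfPochhammer_modEq_self {p N : ℕ} (hp : p.Prime) (h2 : 2 < p) (hN : p = 2 * N + 1) :
    RatModEq p (halfPochhammer N) ((-1) ^ N * N.factorial) := by
  simpa [Nat.descFactorial_self] using halfPochhammer_modEq hp h2 hN N

/-- Past the factor `p / 2`, the product `(1/2)_k` continues as `(1 + p / 2)_j`. -/
theorem halfPochhammer_add {p N : ℕ} (hN : p = 2 * N + 1) (k : ℕ) :
    halfPochhammer (N + 1 + k)
      = halfPochhammer N * (p / 2) * ∏ j ∈ Finset.range k, (1 + j + (p : ℚ) / 2) := by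
  induction k with
  | zero =>
    rw [add_zero, halfPochhammer_succ, hN]
    push_cast
    simp
    left
    ring
  | succ k ih =>
    rw [← add_assoc, halfPochhammer_succ, ih, Finset.prod_range_succ, hN]
    push_cast
    ring

/-- The factors `1 / 2 + j` in reverse order, rewritten by means of `1 / 2 = p / 2 - N`. -/
theorem halfPochhammer_eq_prod {p N : ℕ} (hN : p = 2 * N + 1) :
    halfPochhammer N = (-1) ^ N * ∏ j ∈ Finset.range N, (1 + j - (p : ℚ) / 2) := by
  have h : ∀ k, halfPochhammer k = ∏ j ∈ Finset.range k, (1 / 2 + (j : ℚ)) := by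
    intro k
    induction k with
    | zero => simp [halfPochhammer_zero]
    | succ k ih => rw [halfPochhammer_succ, ih, Finset.prod_range_succ]
  rw [h, ← Finset.prod_range_reflect]
  conv_rhs => rw [← Finset.card_range N, ← Finset.prod_const, Finset.card_range,
    ← Finset.prod_mul_distrib]
  refine Finset.prod_congr rfl fun j hj => ?_
  have hj := Finset.mem_range.mp hj
  rw [Nat.cast_sub (by omega), Nat.cast_sub (by omega), hN]
  push_cast
  ring

theorem prod_one_add_add_half_modEq {p : ℕ} (hp : p.Prime) (h2 : 2 < p) (k : ℕ) :
    RatModEq p (∏ j ∈ Finset.range k, (1 + j + (p : ℚ) / 2)) k.factorial := by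
  induction k with
  | zero => simpa using RatModEq.refl p 1
  | succ k ih =>
    rw [Finset.prod_range_succ, Nat.factorial_succ, mul_comm (k + 1)]
    push_cast
    refine ih.mul ?_ (natCast_mem _ _) (add_mem (natCast_mem _ _) (one_mem _))
    exact ⟨1 / 2, inv_two_mem_coprimeDen hp h2, by ring⟩

/-! ### The boundary term -/

theorem exists_prod_one_sub_eq {R : Subring ℚ} {c : ℚ} (hc : c ∈ R) {x : ℕ → ℚ} (n : ℕ)
    (hx : ∀ j < n, x j ∈ R) :
    ∃ r ∈ R, ∏ j ∈ Finset.range n, (1 - c * x j)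
      = 1 - c * ∑ j ∈ Finset.range n, x j + c ^ 2 * r := by
  induction n with
  | zero => exact ⟨0, zero_mem _, by simp⟩
  | succ n ih =>
    obtain ⟨r, hr, e⟩ := ih fun j hj => hx j (by omega)
    have hS : ∑ j ∈ Finset.range n, x j ∈ R :=
      sum_mem fun j hj => hx j (by have := Finset.mem_range.mp hj; omega)
    have hn := hx n (by omega)
    refine ⟨(∑ j ∈ Finset.range n, x j) * x n + r - c * r * x n, ?_, ?_⟩
    · exact sub_mem (add_mem (mul_mem hS hn) hr) (mul_mem (mul_mem hc hr) hn)
    · rw [Finset.prod_range_succ, Finset.sum_range_succ, e]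
      ring

/-- The factors `j - p / 2` of `(1/2)_N` pair with the factors `j + p / 2` of the rest of
`(1/2)_{2N}`. -/
theorem wzF_self_eq {p N : ℕ} (hN : p = 2 * N + 1) :
    wzF N N = (p : ℚ) * (-1) ^ N *
      ∏ j ∈ Finset.range N, (1 - (p : ℚ) ^ 2 * (1 / 4 * (1 / ((j : ℚ) + 1) ^ 2))) := by
  have h1 : (4 * N + 1 : ℚ) * halfPochhammer (N + N) = 2 * halfPochhammer (N + 1 + N) := by
    rw [show N + 1 + N = N + N + 1 by omega, halfPochhammer_succ]
    push_cast
    ring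
  have h2 : ∏ j ∈ Finset.range N, (1 - (p : ℚ) ^ 2 * (1 / 4 * (1 / ((j : ℚ) + 1) ^ 2)))
      = (∏ j ∈ Finset.range N, (1 + j - (p : ℚ) / 2)) *
        (∏ j ∈ Finset.range N, (1 + j + (p : ℚ) / 2)) / (N.factorial : ℚ) ^ 2 := by
    rw [← Finset.prod_range_add_one_eq_factorial, Nat.cast_prod, ← Finset.prod_pow,
      ← Finset.prod_mul_distrib, ← Finset.prod_div_distrib]
    refine Finset.prod_congr rfl fun j _ => ?_
    push_cast
    field_simp
    ring
  have h3 : (-1 : ℚ) ^ (N + N) = 1 := Even.neg_one_pow ⟨N, rfl⟩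
  have h4 : halfPochhammer N ≠ 0 := (halfPochhammer_pos N).ne'
  have h5 : (N.factorial : ℚ) ≠ 0 := by positivity
  have h6 : wzF N N = 2 * halfPochhammer (N + 1 + N) / (N.factorial : ℚ) ^ 2 := by
    rw [← h1, wzF, h3, Nat.descFactorial_self]
    field_simp
  rw [h6, halfPochhammer_add hN, h2, halfPochhammer_eq_prod hN]
  ring

theorem wzF_self_modEq {p N : ℕ} (hp : p.Prime) (h5 : 5 ≤ p) (hN : p = 2 * N + 1) :
    RatModEq (p ^ 4) (wzF N N) ((p : ℚ) * (-1) ^ N) := by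
  have h2 := inv_two_mem_coprimeDen hp (by omega)
  have h4 : (1 / 4 : ℚ) ∈ coprimeDen p := by
    rw [show (1 / 4 : ℚ) = 1 / 2 * (1 / 2) by norm_num]
    exact mul_mem h2 h2
  obtain ⟨r, hr, e⟩ := exists_prod_one_sub_eq (R := coprimeDen p) (c := (p : ℚ) ^ 2)
    (x := fun j => 1 / 4 * (1 / ((j : ℚ) + 1) ^ 2)) (pow_mem (natCast_mem _ _) _) N (by
      intro j hj
      have := inv_natCast_mem_coprimeDen_of_lt (a := j + 1) hp (by omega) (by omega)
      push_cast at this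
      refine mul_mem h4 ?_
      rw [one_div, ← inv_pow]
      exact pow_mem this _)
  obtain ⟨s, hs, es⟩ := sum_one_div_sq_modEq_zero hp h5 hN
  rw [← Finset.mul_sum] at e
  refine ⟨(-1) ^ N * (-(1 / 4 * s) + p * r), ?_, ?_⟩
  · refine Nat.Coprime.pow_right _ (mem_coprimeDen.mp ?_)
    exact mul_mem (neg_one_pow_mem_coprimeDen _ _)
      (add_mem (neg_mem (mul_mem h4 hs)) (mul_mem (natCast_mem _ _) hr))
  · rw [wzF_self_eq hN, e]
    push_cast
    linear_combination -(1 / 4 : ℚ) * p ^ 3 * (-1) ^ N * es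

/-! ### The telescoped sum -/

/-- An alternating sum of reciprocal binomial coefficients, cleared of its denominator `M!`. -/
theorem sum_neg_one_pow_mul_factorial_mul_factorial (M : ℕ) :
    (M + 2 : ℚ) * ∑ i ∈ Finset.range (M + 1), (-1 : ℚ) ^ i * (i.factorial * (M - i).factorial)
      = (M + 1).factorial * (1 + (-1) ^ M) := by
  have h : ∀ i ∈ Finset.range (M + 1),
      (M + 2 : ℚ) * ((-1 : ℚ) ^ i * (i.factorial * (M - i).factorial))
      = (-1) ^ i * (i.factorial * (M + 1 - i).factorial)
        - (-1) ^ (i + 1) * ((i + 1).factorial * (M + 1 - (i + 1)).factorial) := by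
    intro i hi
    have hi : i ≤ M := Nat.lt_succ_iff.mp (Finset.mem_range.mp hi)
    rw [show M + 1 - (i + 1) = M - i by omega, show M + 1 - i = (M - i) + 1 by omega,
      Nat.factorial_succ, Nat.factorial_succ]
    push_cast [Nat.cast_sub hi]
    ring
  rw [Finset.mul_sum, Finset.sum_congr rfl h,
    Finset.sum_range_sub' fun i => (-1 : ℚ) ^ i * (i.factorial * (M + 1 - i).factorial : ℚ)]
  simp
  ring

theorem sum_neg_one_pow_mul_factorial_div (N : ℕ) :
    ∑ i ∈ Finset.range N, (-1 : ℚ) ^ i *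
        (i.factorial * (N - 1 - i).factorial / (N.factorial * (i + 1)))
      = -∑ j ∈ Finset.range N, (1 + 2 * (-1 : ℚ) ^ (j + 1)) / ((j : ℚ) + 1) ^ 2 := by
  induction N with
  | zero => simp
  | succ N ih =>
    rcases N with _ | M
    · simp; norm_num
    rw [Finset.sum_range_succ _ (M + 1), Finset.sum_range_succ _ (M + 1), neg_add, ← ih]
    have h := sum_neg_one_pow_mul_factorial_mul_factorial M
    -- The factor `i + 1` in the denominator cancels in the difference of consecutive cases.
    have hd : ∑ i ∈ Finset.range (M + 1), (-1 : ℚ) ^ i *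
          (i.factorial * (M + 1 + 1 - 1 - i).factorial / ((M + 1 + 1).factorial * (i + 1)))
        = ∑ i ∈ Finset.range (M + 1), (-1 : ℚ) ^ i *
          (i.factorial * (M + 1 - 1 - i).factorial / ((M + 1).factorial * (i + 1)))
        - (∑ i ∈ Finset.range (M + 1), (-1 : ℚ) ^ i * (i.factorial * (M - i).factorial))
          / (M + 2).factorial := by
      rw [Finset.sum_div, ← Finset.sum_sub_distrib]
      refine Finset.sum_congr rfl fun i hi => ?_
      have hi : i ≤ M := Nat.lt_succ_iff.mp (Finset.mem_range.mp hi)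
      rw [show M + 1 + 1 - 1 - i = (M - i) + 1 by omega, show M + 1 - 1 - i = M - i by omega,
        Nat.factorial_succ (M - i), Nat.factorial_succ (M + 1)]
      have : ((M + 1).factorial : ℚ) ≠ 0 := by positivity
      push_cast [Nat.cast_sub hi]
      field_simp
      ring
    have h1 : ((M + 1).factorial : ℚ) ≠ 0 := by positivity
    have h2 : (M + 2 : ℚ) ≠ 0 := by positivity
    have h3 : ∑ i ∈ Finset.range (M + 1), (-1 : ℚ) ^ i * (i.factorial * (M - i).factorial : ℚ)
        = (M + 1).factorial * (1 + (-1) ^ M) / (M + 2) := by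
      rw [eq_div_iff h2]; linear_combination h
    rw [hd, h3, show M + 1 + 1 - 1 - (M + 1) = 0 by omega, Nat.factorial_succ (M + 1)]
    push_cast
    simp only [pow_succ, Nat.factorial_zero, Nat.cast_one]
    field_simp
    ring

/-- Both `(1/2)_{N+1}`, which occurs squared, and `(1/2)_{N+1+k}` contain the factor `p / 2`. -/
theorem wzG_eq {p N k : ℕ} (hN : p = 2 * N + 1) :
    wzG (N + 1) k = (p : ℚ) ^ 3 * (1 / 4 * (-1) ^ (N + k) * N.descFactorial k *
      ((N.factorial : ℚ)⁻¹ ^ 3 * (halfPochhammer N ^ 3 *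
        (∏ j ∈ Finset.range k, (1 + j + (p : ℚ) / 2)) * (halfPochhammer (k + 1))⁻¹ ^ 2))) := by
  have h1 : halfPochhammer (N + 1) = halfPochhammer N * (p / 2) := by
    simpa using halfPochhammer_add hN 0
  have h2 := (halfPochhammer_pos (k + 1)).ne'
  have h3 : (N.factorial : ℚ) ≠ 0 := by positivity
  rw [wzG, halfPochhammer_add hN, h1, Nat.succ_descFactorial_succ, Nat.factorial_succ,
    show N + 1 + k + 1 = N + k + 2 by omega, pow_add _ _ 2]
  push_cast
  field_simp
  ring

theorem sum_wzG_modEq {p N : ℕ} (hp : p.Prime) (h5 : 5 ≤ p) (hN : p = 2 * N + 1) :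
    RatModEq (p ^ 4) (∑ k ∈ Finset.range N, wzG (N + 1) k)
      ((p : ℚ) ^ 3 * eulerNumber (p - 3)) := by
  have h2 := inv_two_mem_coprimeDen hp (by omega)
  have h4 : (1 / 4 : ℚ) ∈ coprimeDen p := by
    rw [show (1 / 4 : ℚ) = 1 / 2 * (1 / 2) by norm_num]
    exact mul_mem h2 h2
  -- Each rising factorial is replaced by its residue modulo `p`; the quotient simplifies exactly.
  have hterm : ∀ k ∈ Finset.range N, RatModEq p
      (1 / 4 * (-1) ^ (N + k) * N.descFactorial k *
      ((N.factorial : ℚ)⁻¹ ^ 3 * (halfPochhammer N ^ 3 *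
        (∏ j ∈ Finset.range k, (1 + j + (p : ℚ) / 2)) * (halfPochhammer (k + 1))⁻¹ ^ 2)))
      (1 / 4 * (-1) ^ k * (k.factorial * (N - 1 - k).factorial /
        (N.factorial * (((N - 1 - k : ℕ) : ℚ) + 1)))) := by
    intro k hk
    have hk := Finset.mem_range.mp hk
    have hf : (N.factorial : ℚ) ∈ coprimeDen p := natCast_mem _ _
    have hs := fun j => neg_one_pow_mem_coprimeDen p j
    have hD : (N.descFactorial (k + 1) : ℚ) ≠ 0 := by
      exact_mod_cast (Nat.descFactorial_pos.mpr (by omega)).ne'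
    have hDinv : ((-1) ^ (k + 1) * (N.descFactorial (k + 1) : ℚ))⁻¹ ∈ coprimeDen p := by
      have h := Nat.factorial_mul_descFactorial (n := N) (k := k + 1) (by omega)
      have h' : (((N - (k + 1)).factorial : ℕ) : ℚ) * N.descFactorial (k + 1) = N.factorial := by
        exact_mod_cast h
      have : ((-1) ^ (k + 1) * (N.descFactorial (k + 1) : ℚ))⁻¹
          = (-1) ^ (k + 1) * ((N - (k + 1)).factorial : ℕ) * (N.factorial : ℚ)⁻¹ := by
        rw [← h', mul_inv, ← inv_pow]
        have : (((N - (k + 1)).factorial : ℕ) : ℚ) ≠ 0 := by positivity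
        field_simp
      rw [this]
      exact mul_mem (mul_mem (hs _) (natCast_mem _ _)) (inv_factorial_mem_coprimeDen hp (by omega))
    have hinv := (halfPochhammer_modEq hp (by omega) hN (k + 1)).inv
      (inv_halfPochhammer_mem hp hN (by omega)) hDinv (halfPochhammer_pos _).ne'
      (mul_ne_zero (by simp) hD)
    have h1 := ((halfPochhammer_modEq_self hp (by omega) hN).pow (mul_mem (hs _) hf) 3).mul
      (prod_one_add_add_half_modEq hp (by omega) k) (pow_mem (mul_mem (hs _) hf) _)
      (natCast_mem _ _)
    have h3 := h1.mul (hinv.pow hDinv 2)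
      (mul_mem (pow_mem (mul_mem (hs _) hf) _) (natCast_mem _ _)) (pow_mem hDinv _)
    have h6 := RatModEq.mul_left (c := 1 / 4 * (-1) ^ (N + k) * N.descFactorial k *
      (N.factorial : ℚ)⁻¹ ^ 3) (mul_mem (mul_mem (mul_mem h4 (hs _)) (natCast_mem _ _))
        (pow_mem (inv_factorial_mem_coprimeDen hp (by omega)) _)) h3
    rw [mul_assoc _ ((N.factorial : ℚ)⁻¹ ^ 3)] at h6
    refine h6.trans (RatModEq.of_eq ?_)
    obtain ⟨i, rfl⟩ : ∃ i, N = i + 1 + k := ⟨N - 1 - k, by omega⟩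
    have e1 := Nat.factorial_mul_descFactorial (n := i + 1 + k) (k := k) (by omega)
    rw [show i + 1 + k - k = i + 1 by omega, Nat.factorial_succ] at e1
    have e2 : ((i : ℚ) + 1) * i.factorial * (i + 1 + k).descFactorial k
        = (i + 1 + k).factorial := by exact_mod_cast e1
    have hi : ((i : ℚ) + 1) ≠ 0 := by positivity
    have hif : (i.factorial : ℚ) ≠ 0 := by positivity
    have hD' : ((i + 1 + k).descFactorial k : ℚ) ≠ 0 := by
      exact_mod_cast (Nat.descFactorial_pos.mpr (by omega)).ne'
    rw [show i + 1 + k - 1 - k = i by omega, cast_descFactorial_succ, ← e2]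
    have hs2 : ∀ j : ℕ, ((-1 : ℚ) ^ j) ^ 2 = 1 := fun j => by
      rw [← pow_mul, mul_comm, pow_mul]; norm_num
    have hs4 : (-1 : ℚ) ^ (i + 1 + k + k) * ((-1) ^ (i + 1 + k)) ^ 3 = (-1) ^ k := by
      rw [pow_add _ (i + 1 + k) k]
      linear_combination (-1 : ℚ) ^ k * ((((-1 : ℚ) ^ (i + 1 + k)) ^ 2 + 1) * hs2 (i + 1 + k))
    push_cast
    rw [show ((i : ℚ) + 1 + k - k) = i + 1 by ring]
    have hgen : ∀ s t u v d f : ℚ, s * t ^ 3 = u → v ^ 2 = 1 → d ≠ 0 → f ≠ 0 →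
        1 / 4 * s * d * ((i + 1) * f * d)⁻¹ ^ 3 * ((t * ((i + 1) * f * d)) ^ 3 * k.factorial *
          (v * ((i + 1) * d))⁻¹ ^ 2)
        = 1 / 4 * u * (k.factorial * f / ((i + 1) * f * d * (i + 1))) := by
      intro s t u v d f hst hv hd hf
      rw [← hst, inv_pow (v * _), mul_pow v, hv]
      field_simp
    exact hgen _ _ _ _ _ _ hs4 (hs2 _) hD' hif
  have hsum := RatModEq.sum _ hterm
  -- In terms of `i = N - 1 - k` this is the sum evaluated in closed form above.
  have hexact : ∑ k ∈ Finset.range N, (1 / 4 * (-1 : ℚ) ^ k * (k.factorial *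
        (N - 1 - k).factorial / (N.factorial * (((N - 1 - k : ℕ) : ℚ) + 1))))
      = 1 / 4 * (-1) ^ N * (∑ j ∈ Finset.range N, 1 / ((j : ℚ) + 1) ^ 2)
        + 1 / 2 * (-1) ^ N * ∑ j ∈ Finset.range N, (-1 : ℚ) ^ (j + 1) / ((j : ℚ) + 1) ^ 2 := by
    have h := sum_neg_one_pow_mul_factorial_div N
    rw [← Finset.sum_range_reflect]
    have e : ∑ j ∈ Finset.range N, (1 + 2 * (-1 : ℚ) ^ (j + 1)) / ((j : ℚ) + 1) ^ 2
        = (∑ j ∈ Finset.range N, 1 / ((j : ℚ) + 1) ^ 2)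
          + 2 * ∑ j ∈ Finset.range N, (-1 : ℚ) ^ (j + 1) / ((j : ℚ) + 1) ^ 2 := by
      rw [Finset.mul_sum, ← Finset.sum_add_distrib]
      exact Finset.sum_congr rfl fun j _ => by ring
    rw [e] at h
    have e2 : ∑ j ∈ Finset.range N, (1 / 4 * (-1 : ℚ) ^ (N - 1 - j) * ((N - 1 - j).factorial *
          (N - 1 - (N - 1 - j)).factorial /
            (N.factorial * (((N - 1 - (N - 1 - j) : ℕ) : ℚ) + 1))))
        = -(1 / 4 * (-1) ^ N) * ∑ i ∈ Finset.range N, (-1 : ℚ) ^ i *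
        (i.factorial * (N - 1 - i).factorial / (N.factorial * (i + 1))) := by
      rw [Finset.mul_sum]
      refine Finset.sum_congr rfl fun j hj => ?_
      have hj := Finset.mem_range.mp hj
      rw [show N - 1 - (N - 1 - j) = j by omega]
      have hs : (-1 : ℚ) ^ (N - 1 - j) = -((-1) ^ N * (-1) ^ j) := by
        rw [← pow_add, show N + j = (N - 1 - j) + 2 * j + 1 by omega, pow_succ, pow_add, pow_mul]
        norm_num
      rw [hs]
      ring
    rw [e2, h]
    ring
  rw [hexact] at hsum
  have hE := (RatModEq.mul_left (mul_mem h4 (neg_one_pow_mem_coprimeDen p N))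
    (sum_one_div_sq_modEq_zero hp h5 hN)).add (eulerNumber_sub_three_modEq hp h5 hN)
  rw [mul_zero, zero_add] at hE
  have := (hsum.trans hE).pow_mul 3
  rw [Finset.mul_sum] at this
  simp_rw [← wzG_eq hN] at this
  exact this

theorem alternatingCubeSum_one_modEq {p N : ℕ} (hp : p.Prime) (h5 : 5 ≤ p)
    (hN : p = 2 * N + 1) :
    RatModEq (p ^ 4) (alternatingCubeSum 1 p)
      ((p : ℚ) * (-1) ^ N + (p : ℚ) ^ 3 * eulerNumber (p - 3)) := by
  rw [alternatingCubeSum_one_eq p N hN]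
  exact (wzF_self_modEq hp h5 hN).add (sum_wzG_modEq hp h5 hN)

/-! ### Reduction of odd weights to the linear one -/

open Polynomial in
/-- The alternating cube sum up to `N` with weight `x * q (x ^ 2)` at `x = 4 * k + 1`. -/
noncomputable def oddWeightSum (q : ℤ[X]) (N : ℕ) : ℚ :=
  ∑ k ∈ Finset.range (N + 1), (-1 : ℚ) ^ k *
    ((4 * (k : ℚ) + 1) * q.aeval ((4 * (k : ℚ) + 1) ^ 2)) *
      (halfPochhammer k / k.factorial) ^ 3

theorem alternatingCubeSum_eq_oddWeightSum {p N : ℕ} (hN : p = 2 * N + 1) (j : ℕ) :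
    alternatingCubeSum (2 * j + 1) p = oddWeightSum (Polynomial.X ^ j) N := by
  rw [alternatingCubeSum, show (p - 1) / 2 = N by omega, oddWeightSum]
  refine Finset.sum_congr rfl fun k _ => ?_
  rw [ascPochhammer_eval_one, ← halfPochhammer]
  simp only [map_pow, Polynomial.aeval_X]
  rw [pow_succ, pow_mul]
  ring

theorem oddWeightSum_add (q r : Polynomial ℤ) (N : ℕ) :
    oddWeightSum (q + r) N = oddWeightSum q N + oddWeightSum r N := by
  simp only [oddWeightSum, ← Finset.sum_add_distrib, map_add]
  exact Finset.sum_congr rfl fun k _ => by ring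

theorem oddWeightSum_C_mul (a : ℤ) (q : Polynomial ℤ) (N : ℕ) :
    oddWeightSum (Polynomial.C a * q) N = a * oddWeightSum q N := by
  simp only [oddWeightSum, Finset.mul_sum, map_mul, Polynomial.aeval_C]
  exact Finset.sum_congr rfl fun k _ => by simp; ring

open Polynomial in
/-- Splitting of `(x + 1) ^ 3 * (x + 2) ^ (2 * j)` into its odd and even parts, with the odd part
given by a monic polynomial in `x ^ 2`. -/
theorem exists_odd_even_parts (j : ℕ) : ∃ α β : ℤ[X], α.Monic ∧ α.natDegree = j + 1 ∧
    β.natDegree ≤ j + 1 ∧ ∀ x : ℚ,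
      (x + 1) ^ 3 * (x + 2) ^ (2 * j) = x * α.aeval (x ^ 2) + β.aeval (x ^ 2) := by
  induction j with
  | zero =>
    refine ⟨X + C 3, C 3 * X + C 1, monic_X_add_C 3, natDegree_X_add_C 3, ?_, fun x => ?_⟩
    · exact natDegree_linear_le
    · simp only [map_add, map_mul, aeval_X, aeval_C, algebraMap_int_eq, Int.coe_castRingHom]
      push_cast
      ring
  | succ j ih =>
    obtain ⟨α, β, hα, hdα, hdβ, h⟩ := ih
    have hm : ((X + C 4) * α : ℤ[X]).Monic := (monic_X_add_C 4).mul hα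
    have hd : ((X + C 4) * α : ℤ[X]).natDegree = j + 1 + 1 := by
      rw [(monic_X_add_C (4 : ℤ)).natDegree_mul hα, natDegree_X_add_C, hdα]; ring
    have hlt : (C 4 * β).degree < ((X + C 4) * α).degree := by
      rw [degree_eq_natDegree hm.ne_zero, hd]
      refine lt_of_le_of_lt degree_le_natDegree ?_
      exact_mod_cast lt_of_le_of_lt ((natDegree_C_mul_le _ _).trans hdβ) (Nat.lt_succ_self _)
    refine ⟨(X + C 4) * α + C 4 * β, (X + C 4) * β + C 4 * (X * α), hm.add_of_left hlt, ?_, ?_, ?_⟩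
    · rw [natDegree_add_eq_left_of_degree_lt hlt, hd]
    · refine natDegree_add_le_of_degree_le ?_ ?_
      · refine natDegree_mul_le.trans ?_
        rw [natDegree_X_add_C]; omega
      · refine (natDegree_C_mul_le _ _).trans (natDegree_mul_le.trans ?_)
        rw [natDegree_X]; omega
    · intro x
      rw [show 2 * (j + 1) = 2 * j + 2 by ring, pow_add, ← mul_assoc, h]
      simp only [map_add, map_mul, aeval_X, aeval_C, algebraMap_int_eq, Int.coe_castRingHom]
      push_cast
      ring

/-- With `x = 4 * k + 1`, the next value of `4 * k` is `x + 3`, the next value of `4 * k - 1` is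
`x + 2`, and the ratio of consecutive `(1/2)_k / k!` is `(x + 1) / (x + 3)`: the weight below is a
forward difference up to sign. -/
theorem sum_cubic_weight_telescope (j N : ℕ) :
    ∑ k ∈ Finset.range N, (-1 : ℚ) ^ k * ((4 * k + 1 + 1) ^ 3 * (4 * k + 1 + 2) ^ (2 * j)
        + (4 * k + 1 - 1) ^ 3 * (4 * k + 1 - 2) ^ (2 * j)) * (halfPochhammer k / k.factorial) ^ 3
      = -((-1) ^ N * (4 * N) ^ 3 * (4 * N - 1) ^ (2 * j) *
        (halfPochhammer N / N.factorial) ^ 3) := by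
  induction N with
  | zero => simp
  | succ N ih =>
    have : (N.factorial : ℚ) ≠ 0 := by positivity
    rw [Finset.sum_range_succ, ih, halfPochhammer_succ, Nat.factorial_succ, pow_succ]
    push_cast
    rw [show (4 * ((N : ℚ) + 1) - 1) = 4 * N + 1 + 2 by ring,
      show (4 * (N : ℚ) + 1 - 2) = 4 * N - 1 by ring]
    field_simp
    ring

open Polynomial in
/-- In every degree `j + 1` there is a monic weight for which the sum telescopes to
`4 p ^ 3 (-1) ^ N (1 + 2 p) ^ (2 j) ((1/2)_N / N!) ^ 3`, which is `4 p ^ 3` modulo `p ^ 4`. -/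
theorem exists_monic_oddWeightSum_modEq (j : ℕ) : ∃ α : ℤ[X], α.Monic ∧ α.natDegree = j + 1 ∧
    ∀ p N : ℕ, p.Prime → 5 ≤ p → p = 2 * N + 1 →
      RatModEq (p ^ 4) (oddWeightSum α N) ((p : ℚ) ^ 3 * (4 : ℤ)) := by
  obtain ⟨α, β, hα, hd, -, h⟩ := exists_odd_even_parts j
  refine ⟨α, hα, hd, fun p N hp h5 hN => ?_⟩
  have hpQ : (p : ℚ) = 2 * N + 1 := by rw [hN]; push_cast; ring
  have hodd : ∀ x : ℚ, (x + 1) ^ 3 * (x + 2) ^ (2 * j) + (x - 1) ^ 3 * (x - 2) ^ (2 * j)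
      = 2 * (x * α.aeval (x ^ 2)) := by
    intro x
    have h1 := h x
    have h2 := h (-x)
    -- Replacing `x` by `-x` isolates the odd part.
    have e : (-x + 2) ^ (2 * j) = (x - 2) ^ (2 * j) := by
      rw [pow_mul, pow_mul]; congr 1; ring
    rw [e, neg_sq] at h2
    linear_combination h1 - h2
  have heq : oddWeightSum α N = (p : ℚ) ^ 3 * (4 * ((-1) ^ N *
      (1 + 2 * (p : ℚ)) ^ (2 * j) * (halfPochhammer N * (N.factorial : ℚ)⁻¹) ^ 3)) := by
    have ht := sum_cubic_weight_telescope j (N + 1)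
    simp_rw [hodd] at ht
    have e : ∑ k ∈ Finset.range (N + 1), (-1 : ℚ) ^ k *
        (2 * ((4 * (k : ℚ) + 1) * α.aeval ((4 * (k : ℚ) + 1) ^ 2))) *
        (halfPochhammer k / k.factorial) ^ 3 = 2 * oddWeightSum α N := by
      rw [oddWeightSum, Finset.mul_sum]
      exact Finset.sum_congr rfl fun k _ => by ring
    rw [e, halfPochhammer_succ, Nat.factorial_succ, pow_succ] at ht
    push_cast at ht
    rw [show (4 * ((N : ℚ) + 1) - 1) = 1 + 2 * p by rw [hpQ]; ring] at ht
    have : (N.factorial : ℚ) ≠ 0 := by positivity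
    have h2 : 2 * oddWeightSum α N = 2 * ((p : ℚ) ^ 3 * (4 * ((-1) ^ N *
      (1 + 2 * (p : ℚ)) ^ (2 * j) * (halfPochhammer N * (N.factorial : ℚ)⁻¹) ^ 3))) := by
      rw [ht]
      generalize (1 + 2 * (p : ℚ)) ^ (2 * j) = y
      rw [hpQ]
      field_simp
      ring
    exact mul_left_cancel₀ two_ne_zero h2
  rw [heq]
  refine RatModEq.pow_mul 3 ?_
  have hinv := inv_factorial_mem_coprimeDen (a := N) hp (by omega)
  have hs := neg_one_pow_mem_coprimeDen p N
  have hfac : (N.factorial : ℚ) ≠ 0 := by positivity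
  have hh : RatModEq p (halfPochhammer N * (N.factorial : ℚ)⁻¹) ((-1) ^ N) := by
    have := RatModEq.mul_left hinv (halfPochhammer_modEq_self hp (by omega) hN)
    convert this using 1
    · ring
    · field_simp
  have hb : RatModEq p ((1 + 2 * (p : ℚ)) ^ (2 * j)) (1 ^ (2 * j)) :=
    RatModEq.pow ⟨2, by simp, by ring⟩ (one_mem _) _
  have h1 := RatModEq.mul_left (c := 4 * (-1 : ℚ) ^ N)
    (mul_mem (by exact_mod_cast natCast_mem (coprimeDen p) 4) hs)
    (hb.mul (hh.pow hs 3) (pow_mem (one_mem _) _) (pow_mem hs _))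
  convert h1 using 1
  · ring
  · have : ((-1 : ℚ) ^ N) ^ 2 = 1 := by rw [← pow_mul, mul_comm, pow_mul]; norm_num
    push_cast
    rw [one_pow]
    linear_combination -(4 : ℚ) * (((-1 : ℚ) ^ N) ^ 2 + 1) * this

/-- Every weight `x * q (x ^ 2)` with `q` an integral polynomial satisfies the congruence, with
coefficients `a` and `c` independent of the prime. -/
theorem exists_oddWeightSum_modEq (q : Polynomial ℤ) : ∃ a c : ℤ, ∀ p N : ℕ, p.Prime → 5 ≤ p →
    p = 2 * N + 1 → RatModEq (p ^ 4) (oddWeightSum q N)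
      ((a : ℚ) * ((p : ℚ) * (-1 : ℚ) ^ N + (p : ℚ) ^ 3 * eulerNumber (p - 3))
        + (p : ℚ) ^ 3 * (c : ℚ)) := by
  induction hn : q.natDegree using Nat.strong_induction_on generalizing q with
  | _ n ih =>
    rcases n with _ | n
    · obtain ⟨a, rfl⟩ := Polynomial.natDegree_eq_zero.mp hn
      refine ⟨a, 0, fun p N hp h5 hN => ?_⟩
      have h := alternatingCubeSum_one_modEq hp h5 hN
      rw [show (1 : ℕ) = 2 * 0 + 1 by rfl, alternatingCubeSum_eq_oddWeightSum hN, pow_zero] at h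
      rw [← mul_one (Polynomial.C a), oddWeightSum_C_mul, Int.cast_zero, mul_zero, add_zero]
      exact RatModEq.mul_left (intCast_mem _ _) h
    · -- Subtract the multiple of the telescoping weight of the same degree.
      obtain ⟨α, hα, hd, h⟩ := exists_monic_oddWeightSum_modEq n
      set b := q.leadingCoeff with hb
      have hlow : (q - Polynomial.C b * α).natDegree < n + 1 := by
        have hb0 : b ≠ 0 := by
          rw [hb, Polynomial.leadingCoeff_ne_zero]
          rintro rfl
          simp at hn
        have hlc : (Polynomial.C b * α).leadingCoeff = b := by
          rw [Polynomial.leadingCoeff_mul, hα.leadingCoeff, Polynomial.leadingCoeff_C, mul_one]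
        have hnd : (Polynomial.C b * α).natDegree = n + 1 := by
          rw [Polynomial.natDegree_C_mul hb0, hd]
        have hq0 : q ≠ 0 := Polynomial.leadingCoeff_ne_zero.mp hb0
        have hdeg : q.degree = (Polynomial.C b * α).degree := by
          rw [Polynomial.degree_eq_natDegree hq0, hn, ← hnd, Polynomial.degree_eq_natDegree]
          exact mul_ne_zero (by simpa using hb0) hα.ne_zero
        have hlt := Polynomial.degree_sub_lt_left hdeg hq0 (hb.symm.trans hlc.symm)
        by_cases h0 : q - Polynomial.C b * α = 0
        · rw [h0, Polynomial.natDegree_zero]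
          exact Nat.succ_pos n
        · rw [← hn]
          exact Polynomial.natDegree_lt_natDegree h0 hlt
      obtain ⟨a, c, hac⟩ := ih _ hlow _ rfl
      refine ⟨a, c + 4 * b, fun p N hp h5 hN => ?_⟩
      have h1 := (hac p N hp h5 hN).add
        (RatModEq.mul_left (intCast_mem _ b) (h p N hp h5 hN))
      rw [← oddWeightSum_C_mul, ← oddWeightSum_add, sub_add_cancel] at h1
      refine h1.trans (RatModEq.of_eq ?_)
      push_cast
      ring

theorem mainTheorem1 (m : ℕ) (hm : Odd m) :
    ∃ a c : ℤ, ∀ p : ℕ, p.Prime → 5 ≤ p →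
      RatModEq (p ^ 4) (alternatingCubeSum m p)
        ((a : ℚ) * ((p : ℚ) * (-1 : ℚ) ^ ((p - 1) / 2) + (p : ℚ) ^ 3 * eulerNumber (p - 3))
          + (p : ℚ) ^ 3 * (c : ℚ)) := by
  obtain ⟨j, rfl⟩ := hm
  obtain ⟨a, c, h⟩ := exists_oddWeightSum_modEq (Polynomial.X ^ j)
  refine ⟨a, c, fun p hp h5 => ?_⟩
  obtain ⟨N, hN⟩ := hp.odd_of_ne_two (by omega)
  rw [alternatingCubeSum_eq_oddWeightSum hN, show (p - 1) / 2 = N by omega]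
  exact h p N hp h5 hN
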